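/- Let $k$ be a field of characteristic zero. Let $V$ and $W$ be nonsymmetric collections of $k$-vector spaces $V(n)$, $W(n)$, $n\ge 1$, with chosen bases; take the union of these as basis of $V\oplus W$. Let $F_V\subset F_{V\oplus W}$ be the free shuffle operads, with their bases of tree monomials. Fix an admissible ordering of the tree monomials of $F_{V\oplus W}$: in each arity it is a well-ordering, and replacing the operations in any shuffle composition by larger operations of the same arities increases the result. Order the tree monomials of $F_V$ by restriction. The leading term of a nonzero element is the largest tree monomial that occurs in it with nonzero coefficient. A tree monomial $\alpha$ is divisible by a tree monomial $\beta$ if some subtree of $\alpha$, with its leaves renumbered in the order of their smallest descendants, equals $\beta$. A set $G$ of generators of an operadic ideal $M$ is a Gröbner basis of $M$ if the leading term of every nonzero $f\in M$ is divisible by the leading term of some nonzero element of $G$. Let $P=F_V/(R)$ and $Q=F_{V\oplus W}/(R\oplus S)$, where $R\subseteq F_V$ and $S\subseteq F_{V\oplus W}$ are sets of homogeneous relations (elements of a single arity) and $(\cdot)$ denotes the operadic ideal generated by the given relations, $(R\oplus S)$ being the ideal generated by $R$ and $S$ together. **Proposition 4.1.** Assume that $(R\oplus S)$ has a Gröbner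 basis of the form $G\cup T$, where $G\subseteq F_V$ is a Gröbner basis of $(R)$ and $T$ is a set of homogeneous elements of $F_{V\oplus W}$ whose leading terms are tree monomials not belonging to $F_V$. Then the natural morphism of shuffle operads $P\to Q$ is an embedding, that is, the map $P(n)\to Q(n)$ is injective for every $n\ge 1$. -/

import Mathlib

namespace ShuffleOp

universe u v w

/-! ## Shuffle operads -/

/-- A shuffling surjection `f : [n] → [l]` with fibres of sizes `m 1, …, m l`.
It is recorded by the increasing enumerations `emb i : [m i] → [n]` of its fibres `f⁻¹(i)`.
The condition `bij` says that the fibres partition `[n]`, and `shuffling` that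
`min f⁻¹(i) < min f⁻¹(j)` for `i < j`.  All arities are positive. -/
structure Shuffle {l : ℕ+} (m : Fin l → ℕ+) (n : ℕ+) where
  emb : ∀ i, Fin (m i) ↪o Fin n
  bij : Function.Bijective (fun p : (Σ i, Fin (m i)) => emb p.1 p.2)
  shuffling : ∀ i j, i < j → emb i 0 < emb j 0

/-- A shuffle operad over `k`: a nonsymmetric collection `n ↦ carrier n` (on the skeleton
`[1], [2], …` of the category of nonempty finite ordered sets) that is a monoid for the shuffle
composition product, that is, equipped with a unit in arity one and, for every shuffling
surjection, a composition map
`carrier l ⊗ carrier (m 1) ⊗ ⋯ ⊗ carrier (m l) → carrier n`,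
these being unital and associative. In `comp_assoc`, the surjection `[N] → [l]` given by `v` is the
composite of `t : [N] → [n]` and `s : [n] → [l]`, and `u i` is the restriction of `t` to the
preimage of `i`. -/
structure ShuffleOperad (k : Type w) [Field k] where
  carrier : ℕ+ → Type u
  [addCommGroup : ∀ n, AddCommGroup (carrier n)]
  [module : ∀ n, Module k (carrier n)]
  one : carrier 1
  comp : ∀ {l n : ℕ+} {m : Fin l → ℕ+}, Shuffle m n →
    (carrier l →ₗ[k] MultilinearMap k (fun i => carrier (m i)) (carrier n))
  one_comp : ∀ {n : ℕ+} (s : Shuffle (fun _ : Fin (1 : ℕ+) => n) n) (g : carrier n),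
    comp s one (fun _ => g) = g
  comp_one : ∀ {n : ℕ+} (s : Shuffle (fun _ : Fin n => 1) n) (f : carrier n),
    comp s f (fun _ => one) = f
  comp_assoc : ∀ {l n N : ℕ+} {m : Fin l → ℕ+} {p : Fin n → ℕ+} {q : Fin l → ℕ+}
    (s : Shuffle m n) (t : Shuffle p N)
    (u : ∀ i, Shuffle (fun a => p (s.emb i a)) (q i)) (v : Shuffle q N),
    (∀ i a b, v.emb i ((u i).emb a b) = t.emb (s.emb i a) b) →
    ∀ (f : carrier l) (g : ∀ i, carrier (m i)) (h : ∀ j, carrier (p j)),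
      comp t (comp s f g) h = comp v f (fun i => comp (u i) (g i) (fun a => h (s.emb i a)))

attribute [instance] ShuffleOperad.addCommGroup ShuffleOperad.module

namespace ShuffleOperad

variable {k : Type w} [Field k]

/-- A morphism of shuffle operads. -/
structure Hom (P : ShuffleOperad.{u} k) (Q : ShuffleOperad.{v} k) where
  toLin : ∀ n, P.carrier n →ₗ[k] Q.carrier n
  map_one : toLin 1 P.one = Q.one
  map_comp : ∀ {l n : ℕ+} {m : Fin l → ℕ+} (s : Shuffle m n) (f : P.carrier l)
    (g : ∀ i, P.carrier (m i)),
    toLin n (P.comp s f g) = Q.comp s (toLin l f) (fun i => toLin (m i) (g i))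

/-- An embedding of shuffle operads: a morphism that is injective in every arity. -/
def Hom.IsEmbedding {P : ShuffleOperad.{u} k} {Q : ShuffleOperad.{v} k} (φ : Hom P Q) : Prop :=
  ∀ n, Function.Injective (φ.toLin n)

/-- An operadic ideal: a shuffle composition lies in it as soon as one of the composed elements
does. -/
structure OpIdeal (P : ShuffleOperad.{u} k) where
  sub : ∀ n, Submodule k (P.carrier n)
  comp_left : ∀ {l n : ℕ+} {m : Fin l → ℕ+} (s : Shuffle m n) (f : P.carrier l)
    (g : ∀ i, P.carrier (m i)), f ∈ sub l → P.comp s f g ∈ sub n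
  comp_right : ∀ {l n : ℕ+} {m : Fin l → ℕ+} (s : Shuffle m n) (f : P.carrier l)
    (g : ∀ i, P.carrier (m i)) (i : Fin l), g i ∈ sub (m i) → P.comp s f g ∈ sub n

/-- The operadic ideal `(R)` generated by a family of (homogeneous) elements: the smallest
operadic ideal that contains them. -/
def idealSpan (P : ShuffleOperad.{u} k) (R : ∀ n, Set (P.carrier n)) : P.OpIdeal where
  sub n := sInf {M | ∃ I : P.OpIdeal, (∀ m, R m ⊆ I.sub m) ∧ M = I.sub n}
  comp_left s f g hf := by
    simp only [Submodule.mem_sInf, Set.mem_ofPred_eq] at hf ⊢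
    rintro _ ⟨I, hI, rfl⟩
    exact I.comp_left s f g (hf _ ⟨I, hI, rfl⟩)
  comp_right s f g i hg := by
    simp only [Submodule.mem_sInf, Set.mem_ofPred_eq] at hg ⊢
    rintro _ ⟨I, hI, rfl⟩
    exact I.comp_right s f g i (hg _ ⟨I, hI, rfl⟩)

theorem subset_idealSpan (P : ShuffleOperad.{u} k) (R : ∀ n, Set (P.carrier n)) (n : ℕ+) :
    R n ⊆ (P.idealSpan R).sub n := by
  intro x hx
  simp only [idealSpan, SetLike.mem_coe, Submodule.mem_sInf, Set.mem_ofPred_eq]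
  rintro _ ⟨I, hI, rfl⟩
  exact hI n hx

theorem idealSpan_le (P : ShuffleOperad.{u} k) (R : ∀ n, Set (P.carrier n)) (I : P.OpIdeal)
    (h : ∀ n, R n ⊆ I.sub n) (n : ℕ+) : (P.idealSpan R).sub n ≤ I.sub n :=
  sInf_le ⟨I, h, rfl⟩

/-- The preimage of an operadic ideal under a morphism. -/
def OpIdeal.comap {P : ShuffleOperad.{u} k} {Q : ShuffleOperad.{v} k} (φ : Hom P Q)
    (J : Q.OpIdeal) : P.OpIdeal where
  sub n := (J.sub n).comap (φ.toLin n)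
  comp_left s f g hf := by
    rw [Submodule.mem_comap, φ.map_comp]
    exact J.comp_left s _ _ hf
  comp_right s f g i hg := by
    rw [Submodule.mem_comap, φ.map_comp]
    exact J.comp_right s _ _ i hg

/-! ### Quotient operads -/

theorem OpIdeal.comp_sub_mem {P : ShuffleOperad.{u} k} (I : P.OpIdeal) {l n : ℕ+}
    {m : Fin l → ℕ+} (s : Shuffle m n) {f f' : P.carrier l} {g g' : ∀ i, P.carrier (m i)}
    (hf : f - f' ∈ I.sub l) (hg : ∀ i, g i - g' i ∈ I.sub (m i)) :
    P.comp s f g - P.comp s f' g' ∈ I.sub n := by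
  classical
  have key : ∀ A : Finset (Fin l), P.comp s f' (A.piecewise g g') - P.comp s f' g' ∈ I.sub n := by
    intro A
    induction A using Finset.induction_on with
    | empty => simp
    | insert i A hi ih =>
      have h1 : (insert i A).piecewise g g' = Function.update (A.piecewise g g') i (g i) :=
        Finset.piecewise_insert _ _ _ _
      have h2 : A.piecewise g g' = Function.update (A.piecewise g g') i (g' i) := by
        rw [eq_comm, Function.update_eq_self_iff, Finset.piecewise_eq_of_notMem _ _ _ hi]
      have h3 : P.comp s f' ((insert i A).piecewise g g') - P.comp s f' (A.piecewise g g')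
          ∈ I.sub n := by
        rw [h1]
        nth_rewrite 2 [h2]
        rw [← MultilinearMap.map_update_sub]
        apply I.comp_right s _ _ i
        simpa using hg i
      have := (I.sub n).add_mem h3 ih
      simpa using this
  have h1 := key Finset.univ
  rw [Finset.piecewise_univ] at h1
  have h2 : P.comp s f g - P.comp s f' g ∈ I.sub n := by
    have := I.comp_left s (f - f') g hf
    simpa using this
  have := (I.sub n).add_mem h2 h1
  simpa using this

section Quotient

variable (P : ShuffleOperad.{u} k) (I : P.OpIdeal)

/-- Composition of residue classes, computed on representatives. -/
noncomputable def quotCompFun {l n : ℕ+} {m : Fin l → ℕ+} (s : Shuffle m n)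
    (x : P.carrier l ⧸ I.sub l) (y : ∀ i, P.carrier (m i) ⧸ I.sub (m i)) :
    P.carrier n ⧸ I.sub n :=
  (I.sub n).mkQ (P.comp s (Quotient.out x) (fun i => Quotient.out (y i)))

theorem quotCompFun_mk {l n : ℕ+} {m : Fin l → ℕ+} (s : Shuffle m n)
    (f : P.carrier l) (g : ∀ i, P.carrier (m i)) :
    P.quotCompFun I s ((I.sub l).mkQ f) (fun i => (I.sub (m i)).mkQ (g i)) =
      (I.sub n).mkQ (P.comp s f g) := by
  have hout : ∀ {n : ℕ+} (f : P.carrier n),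
      (Quotient.out ((I.sub n).mkQ f) : P.carrier n) - f ∈ I.sub n := by
    intro n f
    rw [← Submodule.Quotient.eq]
    exact Quotient.out_eq _
  unfold quotCompFun
  refine (Submodule.Quotient.eq _).2 ?_
  exact I.comp_sub_mem s (hout f) (fun i => hout (g i))

theorem exists_rep {l : ℕ+} {m : Fin l → ℕ+} (y : ∀ i, P.carrier (m i) ⧸ I.sub (m i)) :
    ∃ g : ∀ i, P.carrier (m i), y = fun i => (I.sub (m i)).mkQ (g i) := by
  choose g hg using fun i => (I.sub (m i)).mkQ_surjective (y i)
  exact ⟨g, funext fun i => (hg i).symm⟩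

theorem update_mkQ [∀ l : ℕ+, DecidableEq (Fin l)] {l : ℕ+} {m : Fin l → ℕ+}
    (g : ∀ i, P.carrier (m i)) (i : Fin l) (a : P.carrier (m i)) :
    Function.update (fun i => (I.sub (m i)).mkQ (g i)) i ((I.sub (m i)).mkQ a) =
      fun j => (I.sub (m j)).mkQ (Function.update g i a j) := by
  funext j
  by_cases h : j = i
  · subst h; simp
  · simp [h]

/-- Composition of residue classes as a multilinear operation. -/
noncomputable def quotComp {l n : ℕ+} {m : Fin l → ℕ+} (s : Shuffle m n) :
    (P.carrier l ⧸ I.sub l) →ₗ[k]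
      MultilinearMap k (fun i => P.carrier (m i) ⧸ I.sub (m i)) (P.carrier n ⧸ I.sub n) where
  toFun x :=
    { toFun := P.quotCompFun I s x
      map_update_add' := by
        intro inst y i a b
        obtain rfl : inst = instDecidableEqFin _ := Subsingleton.elim _ _
        obtain ⟨g, rfl⟩ := P.exists_rep I y
        obtain ⟨f, rfl⟩ := (I.sub l).mkQ_surjective x
        obtain ⟨a, rfl⟩ := (I.sub (m i)).mkQ_surjective a
        obtain ⟨b, rfl⟩ := (I.sub (m i)).mkQ_surjective b
        rw [← map_add, update_mkQ, update_mkQ, update_mkQ]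
        simp only [quotCompFun_mk, MultilinearMap.map_update_add, map_add]
      map_update_smul' := by
        intro inst y i c a
        obtain rfl : inst = instDecidableEqFin _ := Subsingleton.elim _ _
        obtain ⟨g, rfl⟩ := P.exists_rep I y
        obtain ⟨f, rfl⟩ := (I.sub l).mkQ_surjective x
        obtain ⟨a, rfl⟩ := (I.sub (m i)).mkQ_surjective a
        rw [← map_smul, update_mkQ, update_mkQ]
        simp only [quotCompFun_mk, MultilinearMap.map_update_smul, map_smul] }
  map_add' x x' := by
    ext y
    obtain ⟨g, rfl⟩ := P.exists_rep I y
    obtain ⟨f, rfl⟩ := (I.sub l).mkQ_surjective x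
    obtain ⟨f', rfl⟩ := (I.sub l).mkQ_surjective x'
    have h : ∀ x, (I.sub l).mkQ f + (I.sub l).mkQ f' = x → x = (I.sub l).mkQ (f + f') →
        P.quotCompFun I s x (fun i => (I.sub (m i)).mkQ (g i)) =
          P.quotCompFun I s ((I.sub l).mkQ f) (fun i => (I.sub (m i)).mkQ (g i)) +
          P.quotCompFun I s ((I.sub l).mkQ f') (fun i => (I.sub (m i)).mkQ (g i)) := by
      rintro x - rfl
      rw [quotCompFun_mk, quotCompFun_mk, quotCompFun_mk, map_add, add_apply, map_add]
    exact h _ rfl (map_add _ _ _).symm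
  map_smul' c x := by
    ext y
    obtain ⟨g, rfl⟩ := P.exists_rep I y
    obtain ⟨f, rfl⟩ := (I.sub l).mkQ_surjective x
    have h : ∀ x, c • (I.sub l).mkQ f = x → x = (I.sub l).mkQ (c • f) →
        P.quotCompFun I s x (fun i => (I.sub (m i)).mkQ (g i)) =
          c • P.quotCompFun I s ((I.sub l).mkQ f) (fun i => (I.sub (m i)).mkQ (g i)) := by
      rintro x - rfl
      rw [quotCompFun_mk, quotCompFun_mk, map_smul, smul_apply, map_smul]
    exact h _ rfl (map_smul _ _ _).symm

theorem quotComp_mk {l n : ℕ+} {m : Fin l → ℕ+} (s : Shuffle m n)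
    (f : P.carrier l) (g : ∀ i, P.carrier (m i)) :
    P.quotComp I s ((I.sub l).mkQ f) (fun i => (I.sub (m i)).mkQ (g i)) =
      (I.sub n).mkQ (P.comp s f g) :=
  P.quotCompFun_mk I s f g

/-- The quotient operad `P / I`. -/
noncomputable def quotient : ShuffleOperad.{u} k where
  carrier n := P.carrier n ⧸ I.sub n
  one := (I.sub 1).mkQ P.one
  comp s := P.quotComp I s
  one_comp s g := by
    obtain ⟨g, rfl⟩ := (I.sub _).mkQ_surjective g
    rw [quotComp_mk, P.one_comp]
  comp_one s f := by
    obtain ⟨f, rfl⟩ := (I.sub _).mkQ_surjective f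
    exact (P.quotComp_mk I s f (fun _ => P.one)).trans (congrArg _ (P.comp_one s f))
  comp_assoc {l n N m p q} s t u v huv f g h := by
    obtain ⟨f, rfl⟩ := (I.sub _).mkQ_surjective f
    obtain ⟨g, rfl⟩ := P.exists_rep I g
    obtain ⟨h, rfl⟩ := P.exists_rep I h
    have h1 : ∀ i, P.quotComp I (u i) ((I.sub (m i)).mkQ (g i))
        (fun a => (I.sub (p (s.emb i a))).mkQ (h (s.emb i a))) =
        (I.sub (q i)).mkQ (P.comp (u i) (g i) (fun a => h (s.emb i a))) :=
      fun i => P.quotComp_mk I (u i) (g i) (fun a => h (s.emb i a))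
    simp only [h1]
    rw [quotComp_mk, quotComp_mk, quotComp_mk, P.comp_assoc s t u v huv]

end Quotient

/-- The morphism `P / I → Q / J` induced by a morphism `φ : P → Q` with `φ(I) ⊆ J`. -/
noncomputable def quotientMap {P : ShuffleOperad.{u} k} {Q : ShuffleOperad.{v} k} (φ : Hom P Q)
    (I : P.OpIdeal) (J : Q.OpIdeal) (h : ∀ n, I.sub n ≤ (J.sub n).comap (φ.toLin n)) :
    Hom (P.quotient I) (Q.quotient J) where
  toLin n := (I.sub n).mapQ (J.sub n) (φ.toLin n) (h n)
  map_one := congrArg (J.sub 1).mkQ φ.map_one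
  map_comp {l n m} s f g := by
    obtain ⟨f, rfl⟩ := (I.sub _).mkQ_surjective f
    obtain ⟨g, rfl⟩ := P.exists_rep I g
    have h1 := P.quotComp_mk I s f g
    have h2 := Q.quotComp_mk J s (φ.toLin l f) (fun i => φ.toLin (m i) (g i))
    rw [← φ.map_comp] at h2
    exact (congrArg ((I.sub n).mapQ (J.sub n) (φ.toLin n) (h n)) h1).trans h2.symm

end ShuffleOperad

/-! ## Tree monomials -/

/-- Planar rooted trees whose leaves are labelled by `L` and whose vertices with `n` inputs are
labelled by elements of `X n`. -/
inductive PTree (X : ℕ+ → Type u) (L : Type) : Type u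
  | leaf (a : L) : PTree X L
  | node (n : ℕ+) (x : X n) (c : Fin n → PTree X L) : PTree X L

namespace PTree

variable {X : ℕ+ → Type u} {Y : ℕ+ → Type v} {L L' L'' : Type}

/-- The set of labels of the leaves. -/
def leaves : PTree X L → Set L
  | leaf a => {a}
  | node _ _ c => ⋃ i, (c i).leaves

/-- Grafting: replace each leaf labelled `a` by the tree `g a`. -/
def bind : PTree X L → (L → PTree X L') → PTree X L'
  | leaf a, g => g a
  | node n x c, g => node n x (fun i => (c i).bind g)

/-- Relabelling of the leaves. -/
def map (e : L → L') (t : PTree X L) : PTree X L' := t.bind (fun a => leaf (e a))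

/-- Relabelling of the vertices. -/
def mapVert (φ : ∀ n, X n → Y n) : PTree X L → PTree Y L
  | leaf a => leaf a
  | node n x c => node n (φ n x) (fun i => (c i).mapVert φ)

/-- The smallest leaf of `s` is smaller than the smallest leaf of `t`. -/
def MinLT [LT L] (s t : PTree X L) : Prop :=
  ∃ a ∈ s.leaves, ∀ b ∈ t.leaves, a < b

/-- `t` is a canonical planar representative: no label is repeated, and the inputs of each vertex
are ordered from left to right by the minimal leaves that can be reached through them. -/
def IsShuffle [LT L] : PTree X L → Prop
  | leaf _ => True
  | node _ _ c => (∀ i, (c i).IsShuffle) ∧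
      (∀ i j, i ≠ j → Disjoint (c i).leaves (c j).leaves) ∧
      (∀ i j, i < j → MinLT (c i) (c j))

/-- `IsBranch t t'`: the tree `t` consists of a vertex (or leaf) of `t'` and everything
above it. -/
inductive IsBranch (t : PTree X L) : PTree X L → Prop
  | refl : IsBranch t t
  | child (n : ℕ+) (x : X n) (c : Fin n → PTree X L) (i : Fin n) (h : IsBranch t (c i)) :
      IsBranch t (node n x c)

theorem bind_bind (t : PTree X L) (g : L → PTree X L') (h : L' → PTree X L'') :
    (t.bind g).bind h = t.bind (fun a => (g a).bind h) := by
  induction t with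
  | leaf a => rfl
  | node n x c ih => simp [bind, ih]

theorem bind_leaf (t : PTree X L) : t.bind leaf = t := by
  induction t with
  | leaf a => rfl
  | node n x c ih => simp [bind, ih]

theorem leaves_bind (t : PTree X L) (g : L → PTree X L') :
    (t.bind g).leaves = ⋃ a ∈ t.leaves, (g a).leaves := by
  induction t with
  | leaf a => simp [bind, leaves]
  | node n x c ih =>
    simp only [bind, leaves, ih]
    ext y
    simp only [Set.mem_iUnion]
    aesop

theorem leaves_map (t : PTree X L) (e : L → L') : (t.map e).leaves = e '' t.leaves := by
  ext y
  simp [map, leaves_bind, leaves, eq_comm]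

theorem mapVert_bind (φ : ∀ n, X n → Y n) (t : PTree X L) (g : L → PTree X L') :
    (t.bind g).mapVert φ = (t.mapVert φ).bind (fun a => (g a).mapVert φ) := by
  induction t with
  | leaf a => rfl
  | node n x c ih => simp [bind, mapVert, ih]

theorem mapVert_map (φ : ∀ n, X n → Y n) (t : PTree X L) (e : L → L') :
    (t.map e).mapVert φ = (t.mapVert φ).map e :=
  mapVert_bind φ t _

theorem leaves_mapVert (φ : ∀ n, X n → Y n) (t : PTree X L) :
    (t.mapVert φ).leaves = t.leaves := by
  induction t with
  | leaf a => rfl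
  | node n x c ih => simp [leaves, mapVert, ih]

theorem isShuffle_mapVert [LT L] (φ : ∀ n, X n → Y n) {t : PTree X L} (ht : t.IsShuffle) :
    (t.mapVert φ).IsShuffle := by
  induction t with
  | leaf a => trivial
  | node n x c ih =>
    obtain ⟨h1, h2, h3⟩ := ht
    refine ⟨fun i => ih i (h1 i), ?_, ?_⟩
    · simpa only [leaves_mapVert] using h2
    · simpa only [MinLT, leaves_mapVert] using h3

theorem mapVert_injective {φ : ∀ n, X n → Y n} (hφ : ∀ n, Function.Injective (φ n)) :
    Function.Injective (mapVert φ : PTree X L → PTree Y L) := by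
  intro s
  induction s with
  | leaf a => intro t h; cases t <;> simp_all [mapVert]
  | node n x c ih =>
    intro t h
    cases t with
    | leaf a => simp [mapVert] at h
    | node n' x' c' =>
      simp only [mapVert, node.injEq] at h
      obtain ⟨rfl, h1, h2⟩ := h
      rw [heq_eq_eq] at h1 h2
      obtain rfl := hφ _ h1
      congr 1
      funext i
      exact ih i (congrFun h2 i)

theorem isShuffle_map [Preorder L] [Preorder L'] {t : PTree X L} (ht : t.IsShuffle) (e : L → L')
    (he : StrictMono e) (hinj : Function.Injective e) : (t.map e).IsShuffle := by
  induction t with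
  | leaf a => trivial
  | node n x c ih =>
    obtain ⟨h1, h2, h3⟩ := ht
    refine ⟨fun i => ih i (h1 i), fun i j hij => ?_, fun i j hij => ?_⟩
    · have := (leaves_map (c i) e).symm ▸ (leaves_map (c j) e).symm ▸
        (Set.disjoint_image_iff hinj).2 (h2 i j hij)
      exact this
    · obtain ⟨a, ha, hb⟩ := h3 i j hij
      have e1 : ∀ i, ((c i).bind fun a => leaf (e a)).leaves = e '' (c i).leaves :=
        fun i => leaves_map (c i) e
      refine ⟨e a, ?_, ?_⟩
      · rw [e1]; exact ⟨a, ha, rfl⟩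
      · rw [e1]; rintro _ ⟨b, hb', rfl⟩; exact he (hb b hb')

theorem isShuffle_bind [LT L] [LT L'] {t : PTree X L} (ht : t.IsShuffle) (g : L → PTree X L')
    (hg : ∀ a, (g a).IsShuffle) (hd : ∀ a b, a ≠ b → Disjoint (g a).leaves (g b).leaves)
    (hm : ∀ a ∈ t.leaves, ∃ y ∈ (g a).leaves, ∀ b ∈ t.leaves, a < b → ∀ z ∈ (g b).leaves, y < z) :
    (t.bind g).IsShuffle := by
  induction t with
  | leaf a => exact hg a
  | node n x c ih =>
    obtain ⟨h1, h2, h3⟩ := ht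
    refine ⟨fun i => ih i (h1 i) fun a ha => ?_, fun i j hij => ?_, fun i j hij => ?_⟩
    · obtain ⟨y, hy, hz⟩ := hm a (Set.mem_iUnion.2 ⟨i, ha⟩)
      exact ⟨y, hy, fun b hb => hz b (Set.mem_iUnion.2 ⟨i, hb⟩)⟩
    · rw [leaves_bind, leaves_bind]
      simp only [Set.disjoint_iUnion_left, Set.disjoint_iUnion_right]
      intro a ha b hb
      apply hd
      rintro rfl
      exact Set.disjoint_left.1 (h2 i j hij) (by assumption) (by assumption)
    · obtain ⟨a, ha, hb⟩ := h3 i j hij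
      obtain ⟨y, hy, hz⟩ := hm a (Set.mem_iUnion.2 ⟨i, ha⟩)
      refine ⟨y, ?_, ?_⟩
      · rw [leaves_bind]; exact Set.mem_biUnion ha hy
      · intro z hz'
        rw [leaves_bind] at hz'
        simp only [Set.mem_iUnion] at hz'
        obtain ⟨b, hb', hz'⟩ := hz'
        exact hz b (Set.mem_iUnion.2 ⟨j, hb'⟩) (hb b hb') z hz'

end PTree

/-- Tree monomials of arity `n`: planar representatives of decorated trees whose leaves are
labelled, without repetition, by all the elements of `[n]`. -/
def TreeMon (X : ℕ+ → Type u) (n : ℕ+) : Type u :=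
  {t : PTree X (Fin n) // t.IsShuffle ∧ t.leaves = Set.univ}

namespace TreeMon

variable {X : ℕ+ → Type u} {Y : ℕ+ → Type v}

/-- The degenerate tree, without vertices. -/
def one : TreeMon X 1 :=
  ⟨PTree.leaf 0, trivial, Set.eq_univ_of_forall fun i => Subsingleton.elim (α := Fin 1) i 0⟩

/-- Shuffle composition of tree monomials: graft `β i` at the leaf `i` of `α`, its leaves being
relabelled by the `i`-th fibre of the shuffling surjection. -/
def comp {l n : ℕ+} {m : Fin l → ℕ+} (s : Shuffle m n) (α : TreeMon X l)
    (β : ∀ i, TreeMon X (m i)) : TreeMon X n :=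
  ⟨α.1.bind (fun i => (β i).1.map (s.emb i)), by
    have hl : ∀ i, ((β i).1.map (s.emb i)).leaves = Set.range (s.emb i) := by
      intro i; rw [PTree.leaves_map, (β i).2.2, Set.image_univ]
    constructor
    · apply PTree.isShuffle_bind α.2.1
      · exact fun i => PTree.isShuffle_map (β i).2.1 _ (s.emb i).strictMono (s.emb i).injective
      · intro i j hij
        rw [hl, hl, Set.disjoint_left]
        rintro _ ⟨a, rfl⟩ ⟨b, hb⟩
        have := s.bij.1 (a₁ := ⟨j, b⟩) (a₂ := ⟨i, a⟩) hb
        exact hij (congrArg Sigma.fst this).symm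
      · intro i _
        refine ⟨s.emb i 0, by rw [hl]; exact ⟨0, rfl⟩, ?_⟩
        intro j _ hij z hz
        rw [hl] at hz
        obtain ⟨b, rfl⟩ := hz
        exact (s.shuffling i j hij).trans_le ((s.emb j).monotone (Fin.zero_le _))
    · rw [PTree.leaves_bind, α.2.2]
      ext y
      obtain ⟨⟨i, a⟩, rfl⟩ := s.bij.2 y
      simp only [Set.mem_iUnion, hl, Set.mem_univ, iff_true]
      exact ⟨i, trivial, a, rfl⟩⟩

/-- Change of the decorations of the vertices. -/
def mapVert (φ : ∀ n, X n → Y n) {n : ℕ+} (α : TreeMon X n) : TreeMon Y n :=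
  ⟨α.1.mapVert φ, PTree.isShuffle_mapVert φ α.2.1, by rw [PTree.leaves_mapVert, α.2.2]⟩

/-- `β.Divides α`: some subtree `T'` of the underlying tree of `α` gives, after its leaves have been
renumbered according to their smallest descendants, the tree monomial `β`.  Here `T'` is the bottom
part of the branch `t` of `α` above the root of `T'`; in `t` the subtree `g i` is attached to the
leaf `i` of `T'`. -/
def Divides {m n : ℕ+} (β : TreeMon X m) (α : TreeMon X n) : Prop :=
  ∃ (t : PTree X (Fin n)) (g : Fin m → PTree X (Fin n)),
    PTree.IsBranch t α.1 ∧ t = β.1.bind g ∧ ∀ i j, i < j → PTree.MinLT (g i) (g j)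

theorem mapVert_comp (φ : ∀ n, X n → Y n) {l n : ℕ+} {m : Fin l → ℕ+} (s : Shuffle m n)
    (α : TreeMon X l) (β : ∀ i, TreeMon X (m i)) :
    (comp s α β).mapVert φ = comp s (α.mapVert φ) (fun i => (β i).mapVert φ) := by
  apply Subtype.ext
  simp only [mapVert, comp, PTree.mapVert_bind, PTree.mapVert_map]

theorem mapVert_injective {φ : ∀ n, X n → Y n} (hφ : ∀ n, Function.Injective (φ n)) {n : ℕ+} :
    Function.Injective (mapVert φ : TreeMon X n → TreeMon Y n) := fun _ _ h =>
  Subtype.ext (PTree.mapVert_injective hφ (congrArg Subtype.val h))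

theorem shuffle_emb_eq_self {n : ℕ+} (e : Fin n ↪o Fin n) (a : Fin n) : e a = a := by
  have h : (e : Fin n → Fin n) = id := by
    rw [← StrictMono.range_inj e.strictMono strictMono_id, Set.range_id]
    exact (Finite.injective_iff_surjective.1 e.injective).range_eq
  rw [h]; rfl

theorem one_comp {n : ℕ+} (s : Shuffle (fun _ : Fin (1 : ℕ+) => n) n) (α : TreeMon X n) :
    comp s one (fun _ => α) = α := by
  apply Subtype.ext
  change α.1.bind (fun a => PTree.leaf (s.emb 0 a)) = α.1
  simp only [shuffle_emb_eq_self, PTree.bind_leaf]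

theorem comp_one {n : ℕ+} (s : Shuffle (fun _ : Fin n => 1) n) (α : TreeMon X n) :
    comp s α (fun _ => one) = α := by
  have hs : StrictMono (fun i => s.emb i 0) := fun i j hij => s.shuffling i j hij
  have h : ∀ i, s.emb i 0 = i :=
    shuffle_emb_eq_self (OrderEmbedding.ofStrictMono (fun i => s.emb i 0) hs)
  apply Subtype.ext
  change α.1.bind (fun i => PTree.leaf (s.emb i 0)) = α.1
  simp only [h, PTree.bind_leaf]

theorem comp_assoc {l n N : ℕ+} {m : Fin l → ℕ+} {p : Fin n → ℕ+} {q : Fin l → ℕ+}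
    (s : Shuffle m n) (t : Shuffle p N)
    (u : ∀ i, Shuffle (fun a => p (s.emb i a)) (q i)) (v : Shuffle q N)
    (huv : ∀ i a b, v.emb i ((u i).emb a b) = t.emb (s.emb i a) b)
    (α : TreeMon X l) (β : ∀ i, TreeMon X (m i)) (γ : ∀ j, TreeMon X (p j)) :
    comp t (comp s α β) γ = comp v α (fun i => comp (u i) (β i) (fun a => γ (s.emb i a))) := by
  apply Subtype.ext
  simp only [comp, PTree.map, PTree.bind_bind, PTree.bind, huv]

end TreeMon

/-! ## Free operads -/

section Free

variable (k : Type w) [Field k] (X : ℕ+ → Type u)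

open scoped Classical in
/-- The multilinear extension of the shuffle composition of tree monomials. -/
noncomputable def freeComp {l n : ℕ+} {m : Fin l → ℕ+} (s : Shuffle m n) :
    (TreeMon X l →₀ k) →ₗ[k]
      MultilinearMap k (fun i => TreeMon X (m i) →₀ k) (TreeMon X n →₀ k) :=
  Finsupp.linearCombination k (fun α =>
    ((Finsupp.lmapDomain k k (TreeMon.comp s α)) ∘ₗ
      (PiTensorProduct.ofFinsuppEquiv' (R := k)
        (κ := fun i => TreeMon X (m i))).toLinearMap).compMultilinearMap (PiTensorProduct.tprod k))

theorem freeComp_single {l n : ℕ+} {m : Fin l → ℕ+} (s : Shuffle m n) (α : TreeMon X l) (a : k)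
    (β : ∀ i, TreeMon X (m i)) (b : Fin l → k) :
    freeComp k X s (Finsupp.single α a) (fun i => Finsupp.single (β i) (b i)) =
      Finsupp.single (TreeMon.comp s α β) (a * ∏ i, b i) := by
  simp [freeComp]

theorem freeComp_assoc {l n N : ℕ+} {m : Fin l → ℕ+} {p : Fin n → ℕ+} {q : Fin l → ℕ+}
    (s : Shuffle m n) (t : Shuffle p N)
    (u : ∀ i, Shuffle (fun a => p (s.emb i a)) (q i)) (v : Shuffle q N)
    (huv : ∀ i a b, v.emb i ((u i).emb a b) = t.emb (s.emb i a) b)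
    (f : TreeMon X l →₀ k) (g : ∀ i, TreeMon X (m i) →₀ k) (h : ∀ j, TreeMon X (p j) →₀ k) :
    freeComp k X t (freeComp k X s f g) h =
      freeComp k X v f (fun i => freeComp k X (u i) (g i) (fun a => h (s.emb i a))) := by
  classical
  induction f using Finsupp.induction_linear with
  | zero => simp
  | add f f' hf hf' => simp only [map_add, add_apply, hf, hf']
  | single α a =>
  let L : (TreeMon X n →₀ k) →ₗ[k] (TreeMon X N →₀ k) :=
    { toFun := fun x => freeComp k X t x h
      map_add' := by simp
      map_smul' := by simp }
  let M : ∀ i, (TreeMon X (m i) →₀ k) →ₗ[k] (TreeMon X (q i) →₀ k) := fun i =>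
    { toFun := fun x => freeComp k X (u i) x (fun a => h (s.emb i a))
      map_add' := by simp
      map_smul' := by simp }
  have hg : L.compMultilinearMap (freeComp k X s (Finsupp.single α a)) =
      (freeComp k X v (Finsupp.single α a)).compLinearMap M := by
    refine Module.Basis.ext_multilinear (fun i => Finsupp.basisSingleOne) fun β => ?_
    simp only [Finsupp.coe_basisSingleOne, LinearMap.compMultilinearMap_apply,
      MultilinearMap.compLinearMap_apply, L, M, LinearMap.coe_mk, AddHom.coe_mk]
    let e := (Equiv.ofBijective _ s.bij).symm
    let B : MultilinearMap k (fun j => TreeMon X (p j) →₀ k) (TreeMon X N →₀ k) :=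
      (MultilinearMap.domDomCongrLinearEquiv' k k (fun j => TreeMon X (p j) →₀ k)
        (TreeMon X N →₀ k) e).symm
        ((freeComp k X v (Finsupp.single α a)).compMultilinearMap
          (fun i => freeComp k X (u i) (Finsupp.single (β i) 1)))
    have hB : ∀ h, B h = freeComp k X v (Finsupp.single α a)
        (fun i => freeComp k X (u i) (Finsupp.single (β i) 1) (fun a => h (s.emb i a))) :=
      fun h => rfl
    rw [← hB]
    refine congrArg (fun F => F h) (?_ : freeComp k X t _ = B)
    refine Module.Basis.ext_multilinear (fun i => Finsupp.basisSingleOne) fun γ => ?_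
    simp only [hB, Finsupp.coe_basisSingleOne, freeComp_single, Finset.prod_const_one, mul_one,
      TreeMon.comp_assoc s t u v huv]
  exact congrArg (fun F => F g) hg

/-- The free shuffle operad `F_V` generated by the collection `V` for which `X n` is a basis of
`V(n)`: its component of arity `n` has the tree monomials of arity `n` as a basis. -/
noncomputable def free : ShuffleOperad.{max u w} k where
  carrier n := TreeMon X n →₀ k
  one := Finsupp.single TreeMon.one 1
  comp s := freeComp k X s
  one_comp s g := by
    have : Subsingleton (Fin (1 : ℕ+)) := inferInstanceAs (Subsingleton (Fin 1))
    have h : (MultilinearMap.ofSubsingleton k _ _ (0 : Fin (1 : ℕ+))).symm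
        (freeComp k X s (Finsupp.single TreeMon.one 1)) = LinearMap.id := by
      refine Finsupp.lhom_ext fun α a => ?_
      have h := freeComp_single k X s TreeMon.one 1 (fun _ => α) (fun _ => a)
      rw [TreeMon.one_comp, one_mul, Fintype.prod_subsingleton _ 0] at h
      exact h
    exact LinearMap.congr_fun h g
  comp_one s f := by
    induction f using Finsupp.induction_linear with
    | zero => simp
    | add f g hf hg => rw [map_add, add_apply, hf, hg]
    | single a b => rw [freeComp_single, TreeMon.comp_one]; simp
  comp_assoc s t u v huv f g h := freeComp_assoc k X s t u v huv f g h

variable {X} {Y : ℕ+ → Type v}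

theorem freeComp_mapVert (φ : ∀ n, X n → Y n) {l n : ℕ+} {m : Fin l → ℕ+} (s : Shuffle m n)
    (f : TreeMon X l →₀ k) (g : ∀ i, TreeMon X (m i) →₀ k) :
    Finsupp.lmapDomain k k (TreeMon.mapVert φ) (freeComp k X s f g) =
      freeComp k Y s (Finsupp.lmapDomain k k (TreeMon.mapVert φ) f)
        (fun i => Finsupp.lmapDomain k k (TreeMon.mapVert φ) (g i)) := by
  induction f using Finsupp.induction_linear with
  | zero => simp
  | add f f' hf hf' => simp only [map_add, add_apply, hf, hf']
  | single α a =>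
    have h : (Finsupp.lmapDomain k k (TreeMon.mapVert φ)).compMultilinearMap
          (freeComp k X s (Finsupp.single α a)) =
        (freeComp k Y s (Finsupp.lmapDomain k k (TreeMon.mapVert φ)
          (Finsupp.single α a))).compLinearMap
            (fun i => Finsupp.lmapDomain k k (TreeMon.mapVert φ)) := by
      refine Module.Basis.ext_multilinear (fun i => Finsupp.basisSingleOne) fun β => ?_
      simp only [Finsupp.coe_basisSingleOne, LinearMap.compMultilinearMap_apply,
        MultilinearMap.compLinearMap_apply, freeComp_single, Finsupp.lmapDomain_apply,
        Finsupp.mapDomain_single, TreeMon.mapVert_comp]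
    exact congrArg (fun F => F g) h

/-- The morphism of free operads induced by a map of the bases of generators. -/
noncomputable def freeMap (φ : ∀ n, X n → Y n) :
    ShuffleOperad.Hom (free k X) (free k Y) where
  toLin n := Finsupp.lmapDomain k k (TreeMon.mapVert φ)
  map_one := Finsupp.mapDomain_single
  map_comp s f g := freeComp_mapVert k φ s f g

end Free

/-! ## Orderings and Gröbner bases -/

/-- An admissible ordering of tree monomials. Only monomials of the same arity need to be
compared; those of each arity are well-ordered, and replacing the operations in a shuffle
composition by larger operations of the same arities increases the result. -/
structure AdmissibleOrder (X : ℕ+ → Type u) where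
  lt : ∀ n, TreeMon X n → TreeMon X n → Prop
  wellOrder : ∀ n, IsWellOrder (TreeMon X n) (lt n)
  comp_lt : ∀ {l n : ℕ+} {m : Fin l → ℕ+} (s : Shuffle m n) (α α' : TreeMon X l)
    (β β' : ∀ i, TreeMon X (m i)),
    (α = α' ∨ lt l α α') → (∀ i, β i = β' i ∨ lt (m i) (β i) (β' i)) →
    (α ≠ α' ∨ β ≠ β') → lt n (TreeMon.comp s α β) (TreeMon.comp s α' β')

/-- The restriction of an admissible ordering along an inclusion of bases of generators. -/
def AdmissibleOrder.restrict {X : ℕ+ → Type u} {Y : ℕ+ → Type v} (ord : AdmissibleOrder Y)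
    (φ : ∀ n, X n → Y n) (hφ : ∀ n, Function.Injective (φ n)) : AdmissibleOrder X where
  lt n α α' := ord.lt n (α.mapVert φ) (α'.mapVert φ)
  wellOrder n :=
    haveI := ord.wellOrder n
    (RelEmbedding.preimage ⟨TreeMon.mapVert φ, TreeMon.mapVert_injective hφ⟩ (ord.lt n)).isWellOrder
  comp_lt s α α' β β' hα hβ h := by
    rw [TreeMon.mapVert_comp, TreeMon.mapVert_comp]
    refine ord.comp_lt s _ _ _ _ (hα.imp_left (congrArg _)) (fun i => (hβ i).imp_left (congrArg _))
      (h.imp (fun h1 h2 => h1 (TreeMon.mapVert_injective hφ h2)) fun h1 h2 => h1 (funext fun i =>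
        TreeMon.mapVert_injective hφ (congrFun h2 i)))

section Groebner

variable {k : Type w} [Field k] {X : ℕ+ → Type u}

/-- `α` is the leading term of `f`: the largest tree monomial that occurs in `f` with a nonzero
coefficient.  (The element `0` has no leading term.) -/
def IsLeadingTerm (ord : AdmissibleOrder X) {n : ℕ+} (f : (free k X).carrier n)
    (α : TreeMon X n) : Prop :=
  α ∈ Finsupp.support f ∧ ∀ β ∈ Finsupp.support f, β ≠ α → ord.lt n β α

/-- `G` is a Gröbner basis of the operadic ideal `M`: a system of generators of `M` such that the
leading term of every (nonzero) element of `M` is divisible by the leading term of some element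
of `G`. -/
def IsGroebnerBasis (ord : AdmissibleOrder X) (G : ∀ n, Set ((free k X).carrier n))
    (M : (free k X).OpIdeal) : Prop :=
  (free k X).idealSpan G = M ∧
    ∀ n, ∀ f ∈ M.sub n, ∀ α, IsLeadingTerm ord f α →
      ∃ m, ∃ g ∈ G m, ∃ β, IsLeadingTerm ord g β ∧ β.Divides α

end Groebner

/-! ## Presented operads -/

section Presentation

variable (k : Type w) [Field k] {X : ℕ+ → Type u} (Y : ℕ+ → Type v)

variable {k} in
/-- The operad `F_V / (R)`. -/
noncomputable abbrev presented (R : ∀ n, Set ((free k X).carrier n)) : ShuffleOperad k :=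
  (free k X).quotient ((free k X).idealSpan R)

/-- The basis of `V ⊕ W` that is the union of the bases of `V` and `W`. -/
abbrev sumBasis (X : ℕ+ → Type u) (Y : ℕ+ → Type v) (n : ℕ+) : Type (max u v) := X n ⊕ Y n

/-- The embedding `F_V ⊆ F_{V ⊕ W}`. -/
noncomputable abbrev freeInl : ShuffleOperad.Hom (free k X) (free k (sumBasis X Y)) :=
  freeMap k (fun _ => Sum.inl)

variable {k Y}

/-- The relations `R ⊕ S` in `F_{V ⊕ W}`: those of `R`, which involve only `V`, and those
of `S`. -/
def sumRel (R : ∀ n, Set ((free k X).carrier n))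
    (S : ∀ n, Set ((free k (sumBasis X Y)).carrier n)) (n : ℕ+) :
    Set ((free k (sumBasis X Y)).carrier n) :=
  (freeInl k Y).toLin n '' R n ∪ S n

/-- The natural morphism `F_V / (R) → F_{V ⊕ W} / (R ⊕ S)`, induced by `F_V ⊆ F_{V ⊕ W}`. -/
noncomputable def naturalMap (R : ∀ n, Set ((free k X).carrier n))
    (S : ∀ n, Set ((free k (sumBasis X Y)).carrier n)) :
    ShuffleOperad.Hom (presented R) (presented (sumRel R S)) :=
  ShuffleOperad.quotientMap (freeInl k Y) _ _ fun n =>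
    (free k X).idealSpan_le R
      (ShuffleOperad.OpIdeal.comap (freeInl k Y) ((free k (sumBasis X Y)).idealSpan (sumRel R S)))
      (fun n x hx => (free k (sumBasis X Y)).subset_idealSpan (sumRel R S) n
        (Or.inl ⟨x, hx, rfl⟩)) n

end Presentation

end ShuffleOp

/-! Write `I` for the ideal `(R)` of `F_V` and `J` for the ideal `(R ⊕ S)` of `F_{V ⊕ W}`. The
kernel of `P(n) → Q(n)` is the image in `P(n)` of `J ∩ F_V`, so injectivity means `J ∩ F_V ⊆ I`.

Since `I ⊆ J ∩ F_V`, it is enough that both have the same leading terms (`le_of_leadingTerms`): one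
subtracts leading terms repeatedly, and the process stops because the order is a well-order. Let `α`
be the leading term of some `f ∈ J ∩ F_V`. It is divisible by the leading term of an element of `G ∪
T`. All vertices of `α` are decorated by `V`, hence so are those of any divisor
(`mem_range_of_divides_mapVert`), which rules out `T`. So `α` is a multiple of the leading term of
some `g ∈ G ⊆ I`.

It remains to see that such a multiple is again a leading term of an element of `I`
(`exists_isLeadingTerm_of_divides`). A multiple is obtained by shuffle compositions with monomials
(`Divides.rec_comp`). The same compositions applied to `g` stay in the ideal, and by admissibility
the leading term of a composite is the composite of the leading terms (`IsLeadingTerm.comp`). -/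

namespace ShuffleOp

universe u v w

/-! ### Combinatorics of grafting and relabelling planar trees -/

namespace PTree

variable {X : ℕ+ → Type u} {Y : ℕ+ → Type v} {L L' : Type}

theorem leaves_finite (t : PTree X L) : t.leaves.Finite := by
  induction t with
  | leaf a => exact Set.finite_singleton a
  | node n x c ih => exact Set.finite_iUnion ih

theorem leaves_nonempty (t : PTree X L) : t.leaves.Nonempty := by
  induction t with
  | leaf a => exact Set.singleton_nonempty a
  | node n x c ih =>
    obtain ⟨a, ha⟩ := ih 0
    exact ⟨a, Set.mem_iUnion.2 ⟨0, ha⟩⟩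

theorem isShuffle_of_mapVert [LT L] {φ : ∀ n, X n → Y n} {t : PTree X L}
    (ht : (t.mapVert φ).IsShuffle) : t.IsShuffle := by
  induction t with
  | leaf a => trivial
  | node n x c ih =>
    obtain ⟨h1, h2, h3⟩ := ht
    refine ⟨fun i => ih i (h1 i), ?_, ?_⟩
    · simpa only [leaves_mapVert] using h2
    · simpa only [MinLT, leaves_mapVert] using h3

/-- A shuffle tree whose leaves lie in the range of an order embedding is a relabelling of a
shuffle tree. -/
theorem exists_map_eq [Preorder L] [Preorder L'] (e : L ↪o L') (t : PTree X L')
    (ht : t.IsShuffle) (hl : t.leaves ⊆ Set.range e) :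
    ∃ t' : PTree X L, t'.IsShuffle ∧ t'.map e = t := by
  induction t with
  | leaf a =>
    obtain ⟨b, rfl⟩ := hl (Set.mem_singleton a)
    exact ⟨leaf b, trivial, rfl⟩
  | node n x c ih =>
    obtain ⟨h1, h2, h3⟩ := ht
    choose c' hc' hce using fun i => ih i (h1 i) ((Set.subset_iUnion _ i).trans hl)
    have hleaves : ∀ i, (c i).leaves = e '' (c' i).leaves := fun i => by
      rw [← hce, leaves_map]
    refine ⟨node n x c', ⟨hc', fun i j hij => ?_, fun i j hij => ?_⟩, ?_⟩
    · have := h2 i j hij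
      rwa [hleaves, hleaves, Set.disjoint_image_iff e.injective] at this
    · obtain ⟨a, ha, hb⟩ := h3 i j hij
      rw [hleaves] at ha
      obtain ⟨a, ha, rfl⟩ := ha
      refine ⟨a, ha, fun b hb' => e.lt_iff_lt.1 (hb _ ?_)⟩
      rw [hleaves]
      exact ⟨b, hb', rfl⟩
    · exact congrArg (node n x) (funext hce)

/-- The trees grafted onto a tree `t` so as to give a shuffle tree are shuffle trees. -/
theorem isShuffle_of_bind [LT L'] {t : PTree X L} {g : L → PTree X L'}
    (h : (t.bind g).IsShuffle) : ∀ a ∈ t.leaves, (g a).IsShuffle := by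
  induction t with
  | leaf b => rintro a rfl; exact h
  | node n x c ih =>
    intro a ha
    obtain ⟨i, hi⟩ := Set.mem_iUnion.1 ha
    exact ih i (h.1 i) a hi

/-- Two leaves reached through different inputs of a vertex are separated by the disjointness
condition at that vertex; otherwise one recurses into their common input. This makes the leaf sets
of the grafted trees the fibres of a surjection. -/
theorem disjoint_of_isShuffle_bind [LT L'] {t : PTree X L} {g : L → PTree X L'}
    (h : (t.bind g).IsShuffle) :
    ∀ a ∈ t.leaves, ∀ b ∈ t.leaves, a ≠ b → Disjoint (g a).leaves (g b).leaves := by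
  induction t with
  | leaf c => rintro a rfl b rfl hab; exact absurd rfl hab
  | node n x c ih =>
    intro a ha b hb hab
    obtain ⟨i, hi⟩ := Set.mem_iUnion.1 ha
    obtain ⟨j, hj⟩ := Set.mem_iUnion.1 hb
    by_cases hij : i = j
    · subst hij
      exact ih i (h.1 i) a hi b hj hab
    · refine (h.2.1 i j hij).mono ?_ ?_ <;> rw [leaves_bind]
      · exact Set.subset_biUnion_of_mem (u := fun a => (g a).leaves) hi
      · exact Set.subset_biUnion_of_mem (u := fun a => (g a).leaves) hj

theorem isBranch_mapVert {φ : ∀ n, X n → Y n} {t : PTree Y L} {s : PTree X L}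
    (h : IsBranch t (s.mapVert φ)) : ∃ t', IsBranch t' s ∧ t'.mapVert φ = t := by
  induction s with
  | leaf a =>
    cases h
    exact ⟨leaf a, .refl, rfl⟩
  | node n x c ih =>
    cases h with
    | refl => exact ⟨node n x c, .refl, rfl⟩
    | child _ _ _ i h =>
      obtain ⟨t', h1, h2⟩ := ih i h
      exact ⟨t', .child n x c i h1, h2⟩

/-- If a grafting has all its vertices in the image of `φ`, so have its constituents. -/
theorem exists_mapVert_eq_of_bind {φ : ∀ n, X n → Y n} (s : PTree Y L) (g : L → PTree Y L')
    (t : PTree X L') (h : t.mapVert φ = s.bind g) :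
    (∃ s' : PTree X L, s'.mapVert φ = s) ∧
      ∀ a ∈ s.leaves, ∃ g' : PTree X L', g'.mapVert φ = g a := by
  induction s generalizing t with
  | leaf a => exact ⟨⟨leaf a, rfl⟩, by rintro _ rfl; exact ⟨t, h⟩⟩
  | node n y c ih =>
    cases t with
    | leaf b => simp [mapVert, bind] at h
    | node n' x d =>
      simp only [mapVert, bind, node.injEq] at h
      obtain ⟨rfl, h1, h2⟩ := h
      rw [heq_eq_eq] at h1 h2
      subst h1
      have hc := fun i => ih i (d i) (congrFun h2 i)
      choose c' hc' using fun i => (hc i).1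
      refine ⟨⟨node n' x c', congrArg (node n' (φ n' x)) (funext hc')⟩, fun a ha => ?_⟩
      obtain ⟨i, hi⟩ := Set.mem_iUnion.1 ha
      exact (hc i).2 a hi

/-- If grafting gives a relabelling, then the grafted trees are themselves relabellings. -/
theorem exists_map_eq_of_bind {e : L → L'} {K : Type} (s : PTree X K) (g : K → PTree X L')
    (t : PTree X L) (h : t.map e = s.bind g) :
    ∀ a ∈ s.leaves, ∃ g' : PTree X L, g'.map e = g a := by
  induction s generalizing t with
  | leaf a => rintro _ rfl; exact ⟨t, h⟩
  | node n y c ih =>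
    cases t with
    | leaf b => simp [map, bind] at h
    | node n' x d =>
      simp only [map, bind, node.injEq] at h
      obtain ⟨rfl, h1, h2⟩ := h
      rw [heq_eq_eq] at h2
      intro a ha
      obtain ⟨i, hi⟩ := Set.mem_iUnion.1 ha
      exact ih i (d i) (congrFun h2 i) a hi

theorem map_injective {e : L → L'} (he : Function.Injective e) :
    Function.Injective (map e : PTree X L → PTree X L') := by
  intro s
  induction s with
  | leaf a =>
    intro t h
    cases t with
    | leaf b => exact congrArg leaf (he (leaf.inj h))
    | node => simp [map, bind] at h
  | node n x c ih =>
    intro t h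
    cases t with
    | leaf a => simp [map, bind] at h
    | node n' x' c' =>
      simp only [map, bind, node.injEq] at h
      obtain ⟨rfl, h1, h2⟩ := h
      rw [heq_eq_eq] at h1 h2
      subst h1
      congr 1
      funext i
      exact ih i (congrFun h2 i)

theorem minLT_map_iff [LT L] [LT L'] {e : L → L'} (he : ∀ a b, e a < e b ↔ a < b)
    (s t : PTree X L) : MinLT (s.map e) (t.map e) ↔ MinLT s t := by
  simp [MinLT, leaves_map, he]

end PTree

/-! ### Divisibility expressed through shuffle compositions -/

namespace TreeMon

variable {X : ℕ+ → Type u} {Y : ℕ+ → Type v}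

/-- A tree monomial obtained by grafting trees, in increasing order of their minimal leaves, onto a
tree monomial `β` is a shuffle composition with `β` at the root. -/
theorem exists_eq_comp {l n : ℕ+} (α : TreeMon X n) (β : TreeMon X l)
    (g : Fin l → PTree X (Fin n)) (h : α.1 = β.1.bind g)
    (hg : ∀ i j, i < j → PTree.MinLT (g i) (g j)) :
    ∃ (m : Fin l → ℕ+) (s : Shuffle m n) (γ : ∀ i, TreeMon X (m i)),
      α = comp s β γ ∧ ∀ i, (γ i).1.map (s.emb i) = g i := by
  classical
  have hβ : ∀ i, i ∈ β.1.leaves := fun i => by rw [β.2.2]; trivial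
  have hsh : (β.1.bind g).IsShuffle := h ▸ α.2.1
  have hfin := fun i => (g i).leaves_finite
  have hmem : ∀ i a, a ∈ (hfin i).toFinset ↔ a ∈ (g i).leaves :=
    fun i a => (hfin i).mem_toFinset
  -- The fibre over `i` is the leaf set of `g i`: it is nonempty, so its size lies in `ℕ+`, and it
  -- is finite, so it has an increasing enumeration.
  let m : Fin l → ℕ+ := fun i => ⟨(hfin i).toFinset.card,
    Finset.card_pos.2 ((hfin i).toFinset_nonempty.2 (g i).leaves_nonempty)⟩
  let emb : ∀ i, Fin (m i) ↪o Fin n := fun i => (hfin i).toFinset.orderEmbOfFin rfl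
  have hrange : ∀ i, Set.range (emb i) = (g i).leaves := fun i => by
    ext a
    rw [← hmem]
    exact (Set.ext_iff.1 (Finset.range_orderEmbOfFin _ rfl) a)
  have hdisj : ∀ i j, i ≠ j → Disjoint (g i).leaves (g j).leaves := fun i j =>
    PTree.disjoint_of_isShuffle_bind hsh i (hβ i) j (hβ j)
  let s : Shuffle m n :=
    { emb := emb
      bij := by
        constructor
        · rintro ⟨i, a⟩ ⟨j, b⟩ hab
          by_cases hij : i = j
          · subst hij
            simpa using hab
          · have ha : emb i a ∈ (g i).leaves := hrange i ▸ ⟨a, rfl⟩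
            have hb : emb i a ∈ (g j).leaves := hrange j ▸ ⟨b, hab.symm⟩
            exact absurd hb (Set.disjoint_left.1 (hdisj i j hij) ha)
        · intro y
          have hy : y ∈ (β.1.bind g).leaves := by rw [← h, α.2.2]; trivial
          simp only [PTree.leaves_bind, Set.mem_iUnion] at hy
          obtain ⟨i, -, hi⟩ := hy
          rw [← hrange] at hi
          obtain ⟨a, ha⟩ := hi
          exact ⟨⟨i, a⟩, ha⟩
      shuffling := by
        intro i j hij
        obtain ⟨a, ha, hb⟩ := hg i j hij
        rw [← hrange] at ha
        obtain ⟨a, rfl⟩ := ha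
        -- `emb i 0` is the minimal leaf of `g i`, hence at most the leaf witnessing `MinLT`.
        exact ((emb i).monotone (Fin.zero_le a)).trans_lt (hb _ (hrange j ▸ ⟨0, rfl⟩)) }
  choose γ hγ hγe using fun i => PTree.exists_map_eq (emb i) (g i)
    (PTree.isShuffle_of_bind hsh i (hβ i)) (hrange i).ge
  refine ⟨m, s, fun i => ⟨γ i, hγ i, ?_⟩, Subtype.ext ?_, hγe⟩
  -- Both leaf sets may be compared after applying `emb i`, where each becomes `(g i).leaves`.
  · apply (Set.image_injective.2 (emb i).injective)
    rw [← PTree.leaves_map, hγe, Set.image_univ, hrange]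
  · rw [h]
    exact congrArg β.1.bind (funext fun i => (hγe i).symm)

/-- The tree monomial with a single vertex. -/
def corolla (n : ℕ+) (x : X n) : TreeMon X n :=
  ⟨PTree.node n x PTree.leaf, ⟨fun _ => trivial,
    fun _ _ hij => Set.disjoint_singleton.2 hij,
    fun i j hij => ⟨i, rfl, by rintro _ rfl; exact hij⟩⟩, by
      ext i
      simp [PTree.leaves]⟩

/-- The branch and the grafted trees that witness the divisibility are pieces of a tree decorated
through `φ`, so they lift; injectivity of `φ` then lifts the factorization too. -/
theorem divides_of_mapVert {φ : ∀ n, X n → Y n} (hφ : ∀ n, Function.Injective (φ n)) {m n : ℕ+}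
    {β : TreeMon X m} {α : TreeMon X n} (h : (β.mapVert φ).Divides (α.mapVert φ)) :
    β.Divides α := by
  obtain ⟨t, g, ht, htg, hg⟩ := h
  obtain ⟨t, ht', rfl⟩ := PTree.isBranch_mapVert ht
  have hβ : ∀ i, i ∈ (β.mapVert φ).1.leaves := fun i => by rw [(β.mapVert φ).2.2]; trivial
  choose g' hg' using fun i => (PTree.exists_mapVert_eq_of_bind _ _ _ htg).2 i (hβ i)
  obtain rfl : (fun i => (g' i).mapVert φ) = g := funext hg'
  refine ⟨t, g', ht', PTree.mapVert_injective hφ ?_, fun i j hij => ?_⟩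
  · rw [htg, PTree.mapVert_bind]; rfl
  · simpa only [PTree.MinLT, PTree.leaves_mapVert] using hg i j hij

/-- A divisor of a tree monomial in the image of `φ` is in the image of `φ`. -/
theorem mem_range_of_divides_mapVert {φ : ∀ n, X n → Y n} {m n : ℕ+}
    {β : TreeMon Y m} {α : TreeMon X n} (h : β.Divides (α.mapVert φ)) :
    β ∈ Set.range (TreeMon.mapVert φ) := by
  obtain ⟨t, g, ht, htg, -⟩ := h
  obtain ⟨t, -, rfl⟩ := PTree.isBranch_mapVert ht
  obtain ⟨b, hb⟩ := (PTree.exists_mapVert_eq_of_bind _ _ _ htg).1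
  refine ⟨⟨b, PTree.isShuffle_of_mapVert (φ := φ) (hb ▸ β.2.1), ?_⟩, Subtype.ext hb⟩
  rw [← PTree.leaves_mapVert φ, hb, β.2.2]

/-- Induction principle for divisibility: a property of tree monomials that holds for the shuffle
compositions with `β` at the root, and passes from `γ i` to `comp s δ γ`, holds for
all multiples of `β`. -/
theorem Divides.rec_comp {m : ℕ+} {β : TreeMon X m} {p : ∀ n, TreeMon X n → Prop}
    (root : ∀ {n : ℕ+} {q : Fin m → ℕ+} (s : Shuffle q n) (γ : ∀ i, TreeMon X (q i)),
      p n (comp s β γ))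
    (graft : ∀ {l n : ℕ+} {q : Fin l → ℕ+} (s : Shuffle q n) (δ : TreeMon X l)
      (γ : ∀ i, TreeMon X (q i)) (i : Fin l), p (q i) (γ i) → p n (comp s δ γ))
    {n : ℕ+} {α : TreeMon X n} (h : β.Divides α) : p n α := by
  obtain ⟨t, g, ht, htg, hg⟩ := h
  -- A branch of `α` carries only some of the labels in `[n]`, so it is not itself a tree monomial.
  -- The induction therefore runs over all monomials `γ` that give the branch after an increasing
  -- relabelling `e`.
  suffices H : ∀ a : PTree X (Fin n), PTree.IsBranch t a → ∀ (q : ℕ+) (e : Fin q ↪o Fin n)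
      (γ : TreeMon X q), γ.1.map e = a → p q γ from
    H α.1 ht n (RelEmbedding.refl _) α (PTree.bind_leaf α.1)
  intro a ha
  induction ha with
  | refl =>
    intro q e γ hγ
    have hβ : ∀ i, i ∈ β.1.leaves := fun i => by rw [β.2.2]; trivial
    -- The branch is the whole of `γ` here. Pulling the grafted trees back along `e` exhibits `γ` as
    -- a composition with `β` at the root.
    choose g' hg' using fun i =>
      PTree.exists_map_eq_of_bind β.1 g γ.1 (hγ.trans htg) i (hβ i)
    have h1 : γ.1 = β.1.bind g' := by
      apply PTree.map_injective e.injective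
      rw [hγ, htg, PTree.map, PTree.bind_bind]
      exact congrArg β.1.bind (funext fun i => (hg' i).symm)
    obtain ⟨r, s, δ, rfl, -⟩ := exists_eq_comp γ β g' h1 fun i j hij => by
      rw [← PTree.minLT_map_iff (e := e) (fun _ _ => e.lt_iff_lt), hg', hg']
      exact hg i j hij
    exact root s δ
  | child l x c i _ ih =>
    intro q e γ hγ
    obtain ⟨⟨⟩ | ⟨l', x', c'⟩, hsh, hl⟩ := γ
    · simp [PTree.map, PTree.bind] at hγ
    simp only [PTree.map, PTree.bind, PTree.node.injEq] at hγ
    obtain ⟨rfl, h1, h2⟩ := hγ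
    rw [heq_eq_eq] at h1 h2
    subst h1
    -- `γ` is its root corolla with its subtrees grafted on. The branch lies in the `i`-th one,
    -- which is `δ i` relabelled by `s.emb i`, so the embedding to carry along is the composite with
    -- `e`.
    obtain ⟨r, s, δ, hδ, hδe⟩ := exists_eq_comp ⟨.node l' x' c', hsh, hl⟩ (corolla l' x') c' rfl
      hsh.2.2
    rw [hδ]
    refine graft s _ δ i (ih _ ((s.emb i).trans e) (δ i) ?_)
    rw [← congrFun h2 i]
    change _ = (c' i).map e
    rw [← hδe, PTree.map, PTree.map, PTree.map, PTree.bind_bind]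
    rfl

end TreeMon

/-! ### Leading terms of compositions and of ideals -/

section LeadingTerm

variable {k : Type w} [Field k] {X : ℕ+ → Type u} {Y : ℕ+ → Type v}

open scoped Classical in
-- Explicit coefficients replace the tensor-product definition of `freeComp`, so that the
-- contribution of the leading terms can be isolated.
theorem freeComp_apply {l n : ℕ+} {m : Fin l → ℕ+} (s : Shuffle m n)
    (f : TreeMon X l →₀ k) (g : ∀ i, TreeMon X (m i) →₀ k) (τ : TreeMon X n) :
    freeComp k X s f g τ = ∑ α ∈ f.support, ∑ β ∈ Fintype.piFinset fun i => (g i).support,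
      if TreeMon.comp s α β = τ then f α * ∏ i, g i (β i) else 0 := by
  have h : ∀ α, freeComp k X s (Finsupp.single α 1) g τ =
      ∑ β ∈ Fintype.piFinset fun i => (g i).support,
        if TreeMon.comp s α β = τ then ∏ i, g i (β i) else 0 := by
    intro α
    have hΦ : ∀ β, PiTensorProduct.ofFinsuppEquiv' (PiTensorProduct.tprod k g) β =
        ∏ i, g i (β i) := PiTensorProduct.ofFinsuppEquiv'_apply_apply g
    have h1 : freeComp k X s (Finsupp.single α 1) g = Finsupp.mapDomain (TreeMon.comp s α)
        (PiTensorProduct.ofFinsuppEquiv' (PiTensorProduct.tprod k g)) := by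
      simp [freeComp]
    -- The coefficient at `β` is a product, so it vanishes outside the product of the supports.
    rw [h1, Finsupp.mapDomain, Finsupp.sum_of_support_subset
      (s := Fintype.piFinset fun i => (g i).support) _ (fun β hβ => ?_) _
      (fun _ _ => Finsupp.single_zero _), Finsupp.finsetSum_apply]
    · simp only [hΦ, Finsupp.single_apply]
    · rw [Finsupp.mem_support_iff, hΦ, Finset.prod_ne_zero_iff] at hβ
      exact Fintype.mem_piFinset.2 fun i => Finsupp.mem_support_iff.2 (hβ i (Finset.mem_univ i))
  have hf : freeComp k X s f g =
      ∑ α ∈ f.support, f α • freeComp k X s (Finsupp.single α 1) g := by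
    conv_lhs => rw [← Finsupp.sum_single f]
    simp only [Finsupp.sum, map_sum, sum_apply]
    refine Finset.sum_congr rfl fun α _ => ?_
    rw [← mul_one (f α), ← smul_eq_mul, ← Finsupp.smul_single, map_smul, smul_apply, smul_eq_mul,
      mul_one]
  rw [hf, Finsupp.finsetSum_apply]
  refine Finset.sum_congr rfl fun α _ => ?_
  rw [Finsupp.smul_apply, h, smul_eq_mul, Finset.mul_sum]
  exact Finset.sum_congr rfl fun β _ => by rw [mul_ite, mul_zero]

/-- By admissibility every other choice of monomials from the supports has a strictly smaller
composite. The top one therefore cannot cancel: its coefficient is the product of the leading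
coefficients, nonzero in a field. -/
theorem IsLeadingTerm.comp {ord : AdmissibleOrder X} {l n : ℕ+} {m : Fin l → ℕ+}
    (s : Shuffle m n) {f : TreeMon X l →₀ k} {g : ∀ i, TreeMon X (m i) →₀ k}
    {α : TreeMon X l} {β : ∀ i, TreeMon X (m i)} (hf : IsLeadingTerm ord f α)
    (hg : ∀ i, IsLeadingTerm ord (g i) (β i)) :
    IsLeadingTerm ord (freeComp k X s f g) (TreeMon.comp s α β) := by
  classical
  have hlt : ∀ α' ∈ f.support, ∀ β' ∈ Fintype.piFinset fun i => (g i).support,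
      (α' ≠ α ∨ β' ≠ β) → ord.lt n (TreeMon.comp s α' β') (TreeMon.comp s α β) := by
    intro α' hα' β' hβ' hne
    rw [Fintype.mem_piFinset] at hβ'
    exact ord.comp_lt s _ _ _ _ (or_iff_not_imp_left.2 (hf.2 α' hα'))
      (fun i => or_iff_not_imp_left.2 ((hg i).2 _ (hβ' i))) hne
  have hirr : ∀ τ, ¬ ord.lt n τ τ := fun τ => have := ord.wellOrder n; irrefl τ
  constructor
  · refine Finsupp.mem_support_iff.2 ?_
    -- Only the pair `(α, β)` contributes: another pair with the same composite would make that
    -- monomial smaller than itself.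
    rw [freeComp_apply, Finset.sum_eq_single_of_mem α hf.1, Finset.sum_eq_single_of_mem β, if_pos rfl]
    · exact mul_ne_zero (Finsupp.mem_support_iff.1 hf.1)
        (Finset.prod_ne_zero_iff.2 fun i _ => Finsupp.mem_support_iff.1 (hg i).1)
    · exact Fintype.mem_piFinset.2 fun i => (hg i).1
    · intro β' hβ' hne
      refine if_neg fun h => hirr (TreeMon.comp s α β) ?_
      exact h ▸ hlt α hf.1 β' hβ' (Or.inr hne)
    · intro α' hα' hne
      refine Finset.sum_eq_zero fun β' hβ' => 
        if_neg fun h => hirr (TreeMon.comp s α β) ?_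
      exact h ▸ hlt α' hα' β' hβ' (Or.inl hne)
  · intro τ hτ hne
    replace hτ := Finsupp.mem_support_iff.1 hτ
    rw [freeComp_apply] at hτ
    obtain ⟨α', hα', h⟩ := Finset.exists_ne_zero_of_sum_ne_zero hτ
    obtain ⟨β', hβ', h⟩ := Finset.exists_ne_zero_of_sum_ne_zero h
    obtain rfl : TreeMon.comp s α' β' = τ := by
      by_contra hc
      exact h (if_neg hc)
    refine hlt α' hα' β' hβ' ?_
    by_contra! hc
    exact hne (by rw [hc.1, hc.2])

theorem isLeadingTerm_single (ord : AdmissibleOrder X) {n : ℕ+} (α : TreeMon X n) :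
    IsLeadingTerm ord (Finsupp.single α (1 : k)) α := by
  have hs : (Finsupp.single α (1 : k)).support = {α} := Finsupp.support_single α one_ne_zero
  exact ⟨hs ▸ Finset.mem_singleton_self α,
    fun β hβ h => absurd (Finset.mem_singleton.1 (hs ▸ hβ)) h⟩

/-- Every multiple of the leading term of an element of an ideal is the leading term of an
element of the ideal. -/
theorem exists_isLeadingTerm_of_divides {ord : AdmissibleOrder X} (I : (free k X).OpIdeal)
    {m n : ℕ+} {g : (free k X).carrier m} (hg : g ∈ I.sub m) {β : TreeMon X m}
    (hβ : IsLeadingTerm ord g β) {α : TreeMon X n} (h : β.Divides α) :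
    ∃ f ∈ I.sub n, IsLeadingTerm ord f α := by
  classical
  refine h.rec_comp (p := fun n α => ∃ f ∈ I.sub n, IsLeadingTerm ord f α) ?_ ?_
  · intro n q s γ
    exact ⟨_, I.comp_left s g (fun i => Finsupp.single (γ i) 1) hg,
      hβ.comp s fun i => isLeadingTerm_single ord (γ i)⟩
  · rintro l n q s δ γ i ⟨f, hf, hα⟩
    -- Compose monomials everywhere except in slot `i`, which receives the ideal element `f` with
    -- leading term `γ i`.
    let e : ∀ j, (free k X).carrier (q j) := fun j => Finsupp.single (γ j) 1
    have hi : Function.update e i f i = f := Function.update_self i f e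
    refine ⟨_, I.comp_right s (Finsupp.single δ 1) (Function.update e i f) i (hi.symm ▸ hf),
      (isLeadingTerm_single ord δ).comp s fun j => ?_⟩
    by_cases hj : j = i
    · subst hj
      exact hi.symm ▸ hα
    · rw [Function.update_of_ne hj]
      exact isLeadingTerm_single ord (γ j)

theorem exists_isLeadingTerm (ord : AdmissibleOrder X) {n : ℕ+} {f : (free k X).carrier n}
    (hf : f ≠ 0) : ∃ α, IsLeadingTerm ord f α := by
  classical
  have := ord.wellOrder n
  let := linearOrderOfSTO (ord.lt n)
  obtain ⟨α, hα, hmax⟩ := (Finsupp.support f).exists_max_image id (Finsupp.support_nonempty_iff.2 hf)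
  exact ⟨α, hα, fun β hβ hne => lt_of_le_of_ne (hmax β hβ) hne⟩

/-- If `M ⊆ N` are subspaces and every leading term of an element of `N` is the leading term of an
element of `M`, then `M = N`. -/
theorem le_of_leadingTerms (ord : AdmissibleOrder X) {n : ℕ+}
    {M N : Submodule k ((free k X).carrier n)} (hMN : M ≤ N)
    (h : ∀ f ∈ N, ∀ α, IsLeadingTerm ord f α → ∃ g ∈ M, IsLeadingTerm ord g α) : N ≤ M := by
  suffices H : ∀ α, ∀ f ∈ N, IsLeadingTerm ord f α → f ∈ M by
    intro f hf
    by_cases h0 : f = 0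
    · exact h0 ▸ M.zero_mem
    · obtain ⟨α, hα⟩ := exists_isLeadingTerm ord h0
      exact H α f hf hα
  have := ord.wellOrder n
  intro α
  induction α using (IsWellFounded.wf (r := ord.lt n)).induction with
  | _ α ih =>
  intro f hf hα
  obtain ⟨g, hg, hgα⟩ := h f hf α hα
  -- With this scalar, `α` cancels in `f - c • g`. Any monomial left occurs in `f` or in `g` and
  -- differs from `α`, hence is smaller, and the induction hypothesis applies.
  let c : k := (show TreeMon X n →₀ k from f) α / (show TreeMon X n →₀ k from g) α
  suffices hsub : f - c • g ∈ M by simpa using M.add_mem hsub (M.smul_mem c hg)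
  by_cases h0 : f - c • g = 0
  · exact h0 ▸ M.zero_mem
  obtain ⟨β, hβ⟩ := exists_isLeadingTerm ord h0
  refine ih β ?_ _ (N.sub_mem hf (N.smul_mem c (hMN hg))) hβ
  have hβ0 := Finsupp.mem_support_iff.1 hβ.1
  change (show TreeMon X n →₀ k from f) β - c * (show TreeMon X n →₀ k from g) β ≠ 0 at hβ0
  have hne : β ≠ α := by
    rintro rfl
    exact hβ0 (by rw [div_mul_cancel₀ _ (Finsupp.mem_support_iff.1 hgα.1), sub_self])
  by_cases hfβ : (show TreeMon X n →₀ k from f) β = 0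
  · refine hgα.2 β (Finsupp.mem_support_iff.2 fun hgβ => hβ0 ?_) hne
    rw [hfβ, hgβ, mul_zero, sub_zero]
  · exact hα.2 β (Finsupp.mem_support_iff.2 hfβ) hne

/-- `mapVert φ` is injective, so it carries the support of `f` bijectively onto that of its image,
and the restricted order is its pullback by definition. -/
theorem isLeadingTerm_restrict_iff {ord : AdmissibleOrder Y} {φ : ∀ n, X n → Y n}
    (hφ : ∀ n, Function.Injective (φ n)) {n : ℕ+} {f : (free k X).carrier n}
    {α : TreeMon X n} :
    IsLeadingTerm (ord.restrict φ hφ) f α ↔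
      IsLeadingTerm ord ((freeMap k φ).toLin n f) (α.mapVert φ) := by
  classical
  have hs : Finsupp.support ((freeMap k φ).toLin n f) =
      (Finsupp.support f).image (TreeMon.mapVert φ) :=
    Finsupp.mapDomain_support_of_injective (TreeMon.mapVert_injective hφ) f
  rw [IsLeadingTerm, IsLeadingTerm, hs, (TreeMon.mapVert_injective hφ).mem_finset_image,
    Finset.forall_mem_image]
  simp only [(TreeMon.mapVert_injective hφ).ne_iff]
  rfl

theorem mem_range_of_isLeadingTerm_freeMap {ord : AdmissibleOrder Y} {φ : ∀ n, X n → Y n}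
    {n : ℕ+} {f : (free k X).carrier n} {β : TreeMon Y n}
    (h : IsLeadingTerm ord ((freeMap k φ).toLin n f) β) : ∃ α : TreeMon X n, α.mapVert φ = β := by
  classical
  obtain ⟨α, -, hα⟩ := Finset.mem_image.1 (Finsupp.mapDomain_support h.1)
  exact ⟨α, hα⟩

end LeadingTerm

end ShuffleOp

/-! ### The embedding of the presented operads -/

theorem proposition4p1 {k : Type*} [Field k] [CharZero k] {X : ℕ+ → Type*} {Y : ℕ+ → Type*}
    -- an admissible ordering of the tree monomials of `F_{V ⊕ W}`
    (ord : ShuffleOp.AdmissibleOrder (ShuffleOp.sumBasis X Y))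
    -- the relations `R` and `S`
    (R : ∀ n, Set ((ShuffleOp.free k X).carrier n))
    (S : ∀ n, Set ((ShuffleOp.free k (ShuffleOp.sumBasis X Y)).carrier n))
    -- `G` is a Gröbner basis of `P = F_V / (R)`
    (G : ∀ n, Set ((ShuffleOp.free k X).carrier n))
    (hG : ShuffleOp.IsGroebnerBasis (ord.restrict (fun _ => Sum.inl) (fun _ => Sum.inl_injective)) G
      ((ShuffleOp.free k X).idealSpan R))
    -- the leading terms of the elements of `T` do not belong to `F_V`
    (T : ∀ n, Set ((ShuffleOp.free k (ShuffleOp.sumBasis X Y)).carrier n))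
    (hT : ∀ n, ∀ t ∈ T n, ∀ α, ShuffleOp.IsLeadingTerm ord t α →
      α ∉ Set.range (ShuffleOp.TreeMon.mapVert (X := X) (fun _ => Sum.inl)))
    -- the union of `G` and `T` is a Gröbner basis of `Q = F_{V ⊕ W} / (R ⊕ S)`
    (hGT : ShuffleOp.IsGroebnerBasis ord
      (fun n => (ShuffleOp.freeInl k Y).toLin n '' G n ∪ T n)
      ((ShuffleOp.free k (ShuffleOp.sumBasis X Y)).idealSpan (ShuffleOp.sumRel R S))) :
    (ShuffleOp.naturalMap R S).IsEmbedding := by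
  have hinj : ∀ n, Function.Injective (Sum.inl : X n → ShuffleOp.sumBasis X Y n) :=
    fun _ => Sum.inl_injective
  intro n
  rw [← LinearMap.ker_eq_bot]
  have hRJ : ((ShuffleOp.free k X).idealSpan R).sub n ≤ Submodule.comap
      ((ShuffleOp.freeInl k Y).toLin n)
      (((ShuffleOp.free k (ShuffleOp.sumBasis X Y)).idealSpan (ShuffleOp.sumRel R S)).sub n) :=
    (ShuffleOp.free k X).idealSpan_le R (ShuffleOp.ShuffleOperad.OpIdeal.comap
      (ShuffleOp.freeInl k Y) _) (fun n x hx =>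
        ShuffleOp.ShuffleOperad.subset_idealSpan _ _ n (Or.inl ⟨x, hx, rfl⟩)) n
  -- The kernel is the image of `J ∩ F_V` in the quotient by `I`; it vanishes as soon as `J ∩ F_V ≤
  -- I`.
  refine (Submodule.ker_mapQ _ _ _ hRJ).trans ?_
  refine LinearMap.le_ker_iff_map.1 (le_trans ?_ (Submodule.ker_mkQ _).ge)
  refine ShuffleOp.le_of_leadingTerms
    (ord.restrict (fun _ => Sum.inl) (fun _ => Sum.inl_injective)) hRJ fun f hf α hα => ?_
  obtain ⟨m, g, hg, β, hβ, hdvd⟩ :=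
    hGT.2 n _ hf _ ((ShuffleOp.isLeadingTerm_restrict_iff hinj).1 hα)
  obtain ⟨g, hg, rfl⟩ | hg := hg
  -- The divisor comes from `G`, so its leading term and the divisibility both descend to `F_V`.
  · obtain ⟨β, rfl⟩ := ShuffleOp.mem_range_of_isLeadingTerm_freeMap hβ
    refine ShuffleOp.exists_isLeadingTerm_of_divides _ (g := g) ?_
      ((ShuffleOp.isLeadingTerm_restrict_iff hinj).2 hβ)
      (ShuffleOp.TreeMon.divides_of_mapVert hinj hdvd)
    rw [← hG.1]
    exact ShuffleOp.ShuffleOperad.subset_idealSpan _ G m hg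
  -- A leading term from `T` involves a generator from `W` and cannot divide a monomial of `F_V`.
  · exact absurd (ShuffleOp.TreeMon.mem_range_of_divides_mapVert hdvd) (hT m g hg β hβ)
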